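/- Let $n\ge 1$, let $S^n\subset\mathbb{R}^{n+1}$ be the unit sphere with its standard surface measure $\mu$, and let $N=(0,\dots,0,1)$ and $S=-N$ be its north and south poles. A function $f:S^n\to\mathbb{R}$ is called radially symmetric and decreasing with respect to a point $u\in S^n$ if there is a non-decreasing function $\phi:[-1,1]\to\mathbb{R}$ with $f(x)=\phi(x\cdot u)$ for all $x\in S^n$. For a continuous $f:S^n\to\mathbb{R}$, let $f^*:S^n\to\mathbb{R}$ denote its symmetric decreasing rearrangement, i.e. the unique function that is radially symmetric and decreasing with respect to $N$, satisfies $\mu(\{f^*>t\})=\mu(\{f>t\})$ for every $t\in\mathbb{R}$, is lower semicontinuous on $S^n\setminus\{S\}$, and has $f^*(S)=\operatorname{ess\,inf}_{S^n} f$. Let $k:[-1,1]\to\mathbb{R}$ be bounded and strictly increasing, and let $f,g:S^n\to\mathbb{R}$ be continuous and both non-constant. Suppose that $$\int_{S^n}\int_{S^n}k(x\cdot y)\,f(x)\,g(y)\,d\mu(x)\,d\mu(y)=\int_{S^n}\int_{S^n}k(x\cdot y)\,f^*(x)\,g^*(y)\,d\mu(x)\,d\mu(y).$$ Then there is a point $u\in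 S^n$ such that both $f$ and $g$ are radially symmetric and decreasing with respect to $u$. -/

import Mathlib

open MeasureTheory Set

/-- The unit sphere `Sⁿ` in `ℝⁿ⁺¹`. -/
abbrev USphere (n : ℕ) : Type := Metric.sphere (0 : EuclideanSpace ℝ (Fin (n + 1))) 1

namespace USphere

/-- The standard surface measure on `Sⁿ`. -/
noncomputable abbrev surf (n : ℕ) : Measure (USphere n) :=
  (volume : Measure (EuclideanSpace ℝ (Fin (n + 1)))).toSphere

/-- The dot product `x · y` of two points of the sphere. -/
noncomputable def dot {n : ℕ} (x y : USphere n) : ℝ :=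
  inner ℝ (x : EuclideanSpace ℝ (Fin (n + 1))) (y : EuclideanSpace ℝ (Fin (n + 1)))

/-- The north pole `(0, …, 0, 1)`. -/
noncomputable def north (n : ℕ) : USphere n :=
  ⟨EuclideanSpace.single (Fin.last n) 1, by simp⟩

/-- The south pole `(0, …, 0, -1)`. -/
noncomputable def south (n : ℕ) : USphere n := -north n

/-- `f` is radially symmetric and decreasing with respect to `u`: `f x = φ (x · u)` for an
increasing (not necessarily strictly increasing) `φ` on `[-1, 1]`. -/
def IsRadialDecreasing {n : ℕ} (f : USphere n → ℝ) (u : USphere n) : Prop :=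
  ∃ φ : ℝ → ℝ, MonotoneOn φ (Icc (-1) 1) ∧ ∀ x, f x = φ (dot x u)

/-- `F` is the symmetric decreasing rearrangement of `f`. -/
structure IsSymmetrization {n : ℕ} (f F : USphere n → ℝ) : Prop where
  radial : IsRadialDecreasing F (north n)
  measure_lt : ∀ t : ℝ, surf n {x | t < f x} = surf n {x | t < F x}
  lsc : LowerSemicontinuousOn F {south n}ᶜ
  south_eq : F (south n) = essInf f (surf n)

/-! ### Existence and uniqueness of the symmetrization of a continuous function -/

section aux

theorem exists_measure_lt {X : Type*} [MeasurableSpace X] (σ : Measure X) [IsFiniteMeasure σ]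
    (h : X → ℝ) (hm : Measurable h) (h0 : ∀ s, σ {x | h x = s} = 0) {s : ℝ} {c : ENNReal}
    (hs : σ {x | s < h x} < c) : ∃ s' < s, σ {x | s' < h x} < c := by
  by_contra! H
  have hanti : Antitone (fun k : ℕ => {x | s - 1 / ((k : ℝ) + 1) < h x}) := by
    intro i j hij x hx
    have h1 : 1 / ((j : ℝ) + 1) ≤ 1 / ((i : ℝ) + 1) := by gcongr
    simp only [mem_ofPred_eq] at hx ⊢
    linarith
  have ht := tendsto_measure_iInter_atTop (μ := σ)
    (fun k => (measurableSet_lt measurable_const hm).nullMeasurableSet) hanti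
    ⟨0, measure_ne_top _ _⟩
  have hI : (⋂ k : ℕ, {x | s - 1 / ((k : ℝ) + 1) < h x}) ⊆ {x | s < h x} ∪ {x | h x = s} := by
    intro x hx
    simp only [mem_iInter, mem_ofPred_eq, mem_union] at hx ⊢
    have : s ≤ h x := by
      by_contra hlt
      push Not at hlt
      obtain ⟨k, hk⟩ := exists_nat_one_div_lt (sub_pos.2 hlt)
      have := hx k
      linarith
    rcases this.lt_or_eq with h | h
    · exact Or.inl h
    · exact Or.inr h.symm
  have hle : c ≤ σ (⋂ k : ℕ, {x | s - 1 / ((k : ℝ) + 1) < h x}) := by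
    refine ge_of_tendsto' ht fun k => H _ ?_
    have : 0 < 1 / ((k : ℝ) + 1) := by positivity
    linarith
  have := calc
    c ≤ _ := hle
    _ ≤ _ := measure_mono hI
    _ ≤ _ := measure_union_le _ _
    _ = σ {x | s < h x} := by rw [h0, add_zero]
  exact absurd hs (not_lt.2 this)

theorem exists_gt_measure_lt {X : Type*} [MeasurableSpace X] (σ : Measure X)
    (h : X → ℝ) {s : ℝ} {c : ENNReal}
    (hs : c < σ {x | s < h x}) : ∃ s' > s, c < σ {x | s' < h x} := by
  by_contra! H
  have hmono : Monotone (fun k : ℕ => {x | s + 1 / ((k : ℝ) + 1) < h x}) := by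
    intro i j hij x hx
    have h1 : 1 / ((j : ℝ) + 1) ≤ 1 / ((i : ℝ) + 1) := by gcongr
    simp only [mem_ofPred_eq] at hx ⊢
    linarith
  have ht := tendsto_measure_iUnion_atTop (μ := σ) hmono
  have hI : {x | s < h x} ⊆ (⋃ k : ℕ, {x | s + 1 / ((k : ℝ) + 1) < h x}) := by
    intro x hx
    simp only [mem_iUnion, mem_ofPred_eq] at hx ⊢
    obtain ⟨k, hk⟩ := exists_nat_one_div_lt (sub_pos.2 hx)
    exact ⟨k, by linarith⟩
  have hle : σ (⋃ k : ℕ, {x | s + 1 / ((k : ℝ) + 1) < h x}) ≤ c := by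
    refine le_of_tendsto' ht fun k => H _ ?_
    have : 0 < 1 / ((k : ℝ) + 1) := by positivity
    simp only [gt_iff_lt]
    linarith
  exact absurd hs (not_lt.2 ((measure_mono hI).trans hle))

theorem measure_measure_lt {X : Type*} [MeasurableSpace X] (σ : Measure X) [IsFiniteMeasure σ]
    (h : X → ℝ) (hm : Measurable h) (h0 : ∀ s, σ {x | h x = s} = 0)
    (hb : ∀ x, -1 ≤ h x ∧ h x ≤ 1) {c : ENNReal} (hc : c ≤ σ univ) :
    σ {x | σ {y | h x < h y} < c} = c := by
  rcases eq_or_ne c 0 with rfl | hc0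
  · simp
  set B : Set ℝ := {s | σ {y | s < h y} < c} with hB
  have hup : ∀ s ∈ B, ∀ s', s ≤ s' → s' ∈ B := fun s hs s' hss' =>
    lt_of_le_of_lt (measure_mono fun x hx => lt_of_le_of_lt hss' hx) hs
  have h1B : (1 : ℝ) ∈ B := by
    have : {y | 1 < h y} = ∅ := by
      ext y; simpa using (hb y).2
    simp only [hB, mem_ofPred_eq, this, measure_empty]
    exact pos_iff_ne_zero.2 hc0
  have hbb : BddBelow B := by
    refine ⟨-2, fun s hs => ?_⟩
    by_contra hlt
    push Not at hlt
    have : {y | s < h y} = univ := by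
      ext y; simp only [mem_ofPred_eq, mem_univ, iff_true]; linarith [(hb y).1]
    simp only [hB, mem_ofPred_eq, this] at hs
    exact absurd hs (not_lt.2 hc)
  set a := sInf B with ha
  have hTsub : {x | σ {y | h x < h y} < c} ⊆ {x | a < h x} ∪ {x | h x = a} := by
    intro x hx
    have : a ≤ h x := csInf_le hbb hx
    rcases this.lt_or_eq with h | h
    · exact Or.inl h
    · exact Or.inr h.symm
  have hsubT : {x | a < h x} ⊆ {x | σ {y | h x < h y} < c} := by
    intro x hx
    obtain ⟨s, hs, hsx⟩ := (csInf_lt_iff hbb ⟨1, h1B⟩).1 hx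
    exact hup s hs _ hsx.le
  have hA1 : σ {x | a < h x} ≤ c := by
    by_contra! hlt
    obtain ⟨s', hs', hlt'⟩ := exists_gt_measure_lt σ h hlt
    obtain ⟨s, hs, hsx⟩ := (csInf_lt_iff hbb ⟨1, h1B⟩).1 hs'
    exact absurd (hup s hs _ hsx.le) (not_lt.2 hlt'.le)
  have hA2 : c ≤ σ {x | a < h x} := by
    by_contra! hlt
    obtain ⟨s', hs', hlt'⟩ := exists_measure_lt σ h hm h0 hlt
    exact absurd (csInf_le hbb hlt') (not_le.2 hs')
  refine le_antisymm ?_ (hA2.trans (measure_mono hsubT))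
  calc _ ≤ _ := measure_mono hTsub
    _ ≤ _ := measure_union_le _ _
    _ = σ {x | a < h x} := by rw [h0, add_zero]
    _ ≤ c := hA1

end aux

variable {n : ℕ}

theorem dot_mem_Icc (x y : USphere n) : dot x y ∈ Icc (-1 : ℝ) 1 := by
  have h := abs_real_inner_le_norm (x : EuclideanSpace ℝ (Fin (n + 1)))
    (y : EuclideanSpace ℝ (Fin (n + 1)))
  rw [norm_eq_of_mem_sphere x, norm_eq_of_mem_sphere y, one_mul] at h
  exact abs_le.1 h

theorem continuous_dot (y : USphere n) : Continuous fun x : USphere n => dot x y := by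
  unfold dot; fun_prop

theorem dot_north_eq_neg_one {x : USphere n} : dot x (north n) = -1 ↔ x = south n := by
  constructor
  · intro h
    have h1 := (inner_eq_neg_one_iff_of_norm_eq_one (𝕜 := ℝ) (norm_eq_of_mem_sphere x)
      (norm_eq_of_mem_sphere (north n))).1 h
    exact Subtype.ext h1
  · rintro rfl
    simp [dot, south]

open scoped Pointwise in
theorem surf_level (hn : 1 ≤ n) (s : ℝ) : surf n {x | dot x (north n) = s} = 0 := by
  have hmeas : MeasurableSet {x : USphere n | dot x (north n) = s} :=
    (isClosed_eq (continuous_dot _) continuous_const).measurableSet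
  rw [surf, Measure.toSphere_apply' _ hmeas]
  set e : EuclideanSpace ℝ (Fin (n + 1)) := (north n : EuclideanSpace ℝ (Fin (n + 1))) with he
  have hen : ‖e‖ = 1 := norm_eq_of_mem_sphere (north n)
  set W : Submodule ℝ (EuclideanSpace ℝ (Fin (n + 1))) := Submodule.span ℝ {e} with hW
  set C : Set (EuclideanSpace ℝ (Fin (n + 1))) := {y | inner ℝ y e = s * ‖y‖} \ W with hC
  have hsub : Ioo (0 : ℝ) 1 • ((↑) '' {x : USphere n | dot x (north n) = s}) ⊆ C ∪ W := by
    rintro _ ⟨r, hr, _, ⟨x, hx, rfl⟩, rfl⟩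
    by_cases hw : r • (x : EuclideanSpace ℝ (Fin (n + 1))) ∈ W
    · exact Or.inr hw
    · refine Or.inl ⟨?_, hw⟩
      have hx' : inner ℝ (x : EuclideanSpace ℝ (Fin (n + 1))) e = s := hx
      simp only [mem_ofPred_eq, inner_smul_left, norm_smul, norm_eq_of_mem_sphere x, hx']
      simp [abs_of_pos hr.1]; ring
  have hWtop : W ≠ ⊤ := by
    intro h
    have h1 := finrank_span_singleton (K := ℝ) (v := e) (by intro h0; simp [h0] at hen)
    rw [← hW, h, finrank_top, finrank_euclideanSpace, Fintype.card_fin] at h1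
    omega
  have hW0 : volume (W : Set (EuclideanSpace ℝ (Fin (n + 1)))) = 0 :=
    Measure.addHaar_submodule volume W hWtop
  have hCm : MeasurableSet C :=
    (isClosed_eq (by fun_prop) (by fun_prop)).measurableSet.diff
      (Submodule.closed_of_finiteDimensional W).measurableSet
  have hC0 : volume C = 0 := by
    refine Measure.addHaar_eq_zero_of_disjoint_translates volume
      (fun k : ℕ => (1 / ((k : ℝ) + 1)) • e) ?_ ?_ hCm
    · refine (Metric.isBounded_iff_subset_closedBall 0).2 ⟨1, ?_⟩
      rintro _ ⟨k, rfl⟩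
      have h0 : 0 < 1 / ((k : ℝ) + 1) := by positivity
      have : 1 / ((k : ℝ) + 1) ≤ 1 := by
        rw [div_le_one (by positivity)]; linarith [(Nat.cast_nonneg k : (0 : ℝ) ≤ k)]
      rw [mem_closedBall_zero_iff, norm_smul, hen, mul_one, Real.norm_of_nonneg h0.le]
      exact this
    · intro i j hij
      simp only [Function.onFun, singleton_add, disjoint_left]
      rintro _ ⟨y, hy, rfl⟩ ⟨z, hz, hzy⟩
      simp only at hzy
      set t : ℝ := 1 / ((i : ℝ) + 1) - 1 / ((j : ℝ) + 1) with ht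
      have htn : t ≠ 0 := by
        intro h
        have : (1 : ℝ) / ((i : ℝ) + 1) = 1 / ((j : ℝ) + 1) := sub_eq_zero.1 h
        rw [div_eq_div_iff (by positivity) (by positivity)] at this
        apply hij
        exact_mod_cast (by linarith : (i : ℝ) = j)
      have hzt : z - y = t • e := by
        rw [ht, sub_smul, sub_eq_sub_iff_add_eq_add, ← hzy]
        exact add_comm _ _
      have hs1 : |s| ≤ 1 := by
        have h1 := abs_real_inner_le_norm y e
        have hy0 : 0 < ‖y‖ := norm_pos_iff.2 fun h => hy.2 (h ▸ W.zero_mem)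
        rw [hy.1, hen, abs_mul, abs_norm, mul_one] at h1
        exact le_of_mul_le_mul_right (by linarith) hy0
      have h2 : t = s * (‖z‖ - ‖y‖) := by
        have : inner ℝ (z - y) e = t := by
          rw [hzt, inner_smul_left, real_inner_self_eq_norm_sq, hen]; simp
        rw [inner_sub_left, hz.1, hy.1] at this
        linarith
      have h3 : ¬ SameRay ℝ z y := by
        intro hr
        have hr' := hr
        rcases hr with h | h | ⟨r₁, r₂, h1, h2', h3⟩
        · exact hz.2 (h ▸ W.zero_mem)
        · exact hy.2 (h ▸ W.zero_mem)
        · have hz' : z = y + t • e := by rw [← hzt]; abel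
          replace h3 : (r₂ - r₁) • y = r₁ • t • e := by
            rw [sub_smul, ← h3, hz', smul_add, add_sub_cancel_left]
          by_cases h12 : r₂ - r₁ = 0
          · rw [h12, zero_smul, eq_comm, smul_smul, smul_eq_zero] at h3
            rcases h3 with h3 | h3
            · exact (mul_ne_zero h1.ne' htn) h3
            · simp [h3] at hen
          · apply hy.2
            have : y = (r₂ - r₁)⁻¹ • (r₁ • t • e) := by
              rw [← h3, smul_smul, inv_mul_cancel₀ h12, one_smul]
            rw [this]
            exact W.smul_mem _ (W.smul_mem _ (W.smul_mem _ (Submodule.mem_span_singleton_self e)))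
      have h4 := abs_lt_norm_sub_of_not_sameRay h3
      rw [hzt, norm_smul, hen, mul_one, Real.norm_eq_abs] at h4
      have h5 : |t| ≤ |‖z‖ - ‖y‖| := by
        conv_lhs => rw [h2, abs_mul]
        exact mul_le_of_le_one_left (abs_nonneg _) hs1
      linarith
  rw [measure_mono_null hsub (measure_union_null hC0 hW0), mul_zero]

/-- A continuous function on `Sⁿ`, `n ≥ 1`, has a symmetric decreasing rearrangement. -/
theorem exists_isSymmetrization (hn : 1 ≤ n) (f : C(USphere n, ℝ)) :
    ∃ F : USphere n → ℝ, IsSymmetrization f F := by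
  set σ := surf n with hσ
  have hne : σ ≠ 0 := Measure.toSphere_ne_zero _
  have : (ae σ).NeBot := ae_neBot.2 hne
  set h : USphere n → ℝ := fun x => dot x (north n) with hh
  have hcont : Continuous h := continuous_dot _
  have hb : ∀ x, -1 ≤ h x ∧ h x ≤ 1 := fun x => dot_mem_Icc x _
  have h0 : ∀ s, σ {x | h x = s} = 0 := surf_level hn
  have h1 : h (south n) = -1 := dot_north_eq_neg_one.2 rfl
  obtain ⟨M, hM⟩ : ∃ M, ∀ x, |f x| ≤ M := by
    obtain ⟨M, hM⟩ := (isCompact_range f.continuous).isBounded.exists_norm_le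
    exact ⟨M, fun x => hM _ ⟨x, rfl⟩⟩
  set m : ℝ → ENNReal := fun t => σ {x | t < f x} with hm
  have hmanti : ∀ {s t}, s ≤ t → m t ≤ m s := fun hst =>
    measure_mono fun x hx => lt_of_le_of_lt hst hx
  set A : ℝ → ENNReal := fun s => σ {y | s < h y} with hA
  have hAanti : ∀ {s t}, s ≤ t → A t ≤ A s := fun hst =>
    measure_mono fun x hx => lt_of_le_of_lt hst hx
  have hAlt : ∀ s, -1 < s → A s < σ univ := by
    intro s hs
    have hpos : 0 < σ {y | h y < s} :=
      (isOpen_lt hcont continuous_const).measure_pos _ ⟨south n, by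
        simp only [mem_ofPred_eq, h1]; exact hs⟩
    have hd : σ {y | h y < s} + A s ≤ σ univ := by
      have hdis : Disjoint {y | h y < s} {y | s < h y} := by
        rw [disjoint_left]; intro y hy hy'
        simp only [mem_ofPred_eq] at hy hy'
        linarith
      change σ {y | h y < s} + σ {y | s < h y} ≤ σ univ
      rw [← measure_union hdis (measurableSet_lt measurable_const hcont.measurable)]
      exact measure_mono (subset_univ _)
    refine lt_of_lt_of_le ?_ hd
    rw [add_comm]
    exact ENNReal.lt_add_right (measure_ne_top _ _) hpos.ne'
  have hAL : ∀ s t, -1 < s → t < essInf f σ → A s < m t := by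
    intro s t hs ht
    have hbd : Filter.IsBoundedUnder (· ≥ ·) (ae σ) f :=
      Filter.isBoundedUnder_of ⟨-M, fun x => (abs_le.1 (hM x)).1⟩
    have : m t = σ univ := by
      refine measure_congr ?_
      filter_upwards [ae_essInf_le hbd] with x hx
      exact eq_true (lt_of_lt_of_le ht hx)
    rw [this]; exact hAlt s hs
  set E : ℝ → Set ℝ := fun s => {t | A s < m t} with hE
  have hEb : ∀ s, BddAbove (E s) := by
    refine fun s => ⟨M, fun t ht => ?_⟩
    by_contra! hlt
    have : {x | t < f x} = ∅ := by
      ext x; simp only [mem_ofPred_eq, mem_empty_iff_false, iff_false, not_lt]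
      exact ((abs_le.1 (hM x)).2).trans hlt.le
    simp [hE, hm, this] at ht
  have hEne : ∀ s, -1 < s → (E s).Nonempty := fun s hs =>
    ⟨essInf f σ - 1, hAL s _ hs (by linarith)⟩
  set φ : ℝ → ℝ := fun s => if s ≤ -1 then essInf f σ else sSup (E s) with hφ
  have hφlt : ∀ s t, -1 < s → (t < φ s ↔ A s < m t) := by
    intro s t hs
    simp only [hφ, if_neg (not_le.2 hs)]
    constructor
    · intro ht
      obtain ⟨t', ht', htt'⟩ := exists_lt_of_lt_csSup (hEne s hs) ht
      exact lt_of_lt_of_le ht' (hmanti htt'.le)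
    · intro ht
      obtain ⟨t', ht', htt'⟩ := exists_gt_measure_lt σ f ht
      exact lt_of_lt_of_le ht' (le_csSup (hEb s) htt')
  have hLφ : ∀ s, essInf f σ ≤ φ s := by
    intro s
    by_cases hs : s ≤ -1
    · simp [hφ, hs]
    · refine le_of_forall_lt fun t ht => (hφlt s t (not_le.1 hs)).2 (hAL s t (not_le.1 hs) ht)
  have hφmono : Monotone φ := by
    intro s s' hss'
    by_cases hs : s ≤ -1
    · have : φ s = essInf f σ := by simp [hφ, hs]
      rw [this]; exact hLφ s'
    · push Not at hs
      refine le_of_forall_lt fun t ht => (hφlt s' t (hs.trans_le hss')).2 ?_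
      exact lt_of_le_of_lt (hAanti hss') ((hφlt s t hs).1 ht)
  have hns : ∀ x, x ≠ south n → -1 < h x := fun x hx =>
    lt_of_le_of_ne (hb x).1 fun h' => hx (dot_north_eq_neg_one.1 h'.symm)
  have hS0 : σ {south n} = 0 := by
    have : ({south n} : Set (USphere n)) = {x | h x = -1} := by
      ext x; exact dot_north_eq_neg_one.symm
    rw [this]; exact h0 _
  refine ⟨fun x => φ (h x), ⟨φ, hφmono.monotoneOn _, fun x => rfl⟩, ?_, ?_, ?_⟩
  · intro t
    have key := measure_measure_lt σ h hcont.measurable h0 hb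
      (c := m t) (measure_mono (subset_univ _))
    have : σ {x | t < φ (h x)} = σ {x | σ {y | h x < h y} < m t} := by
      refine measure_congr ?_
      have hae : ∀ᵐ x ∂σ, x ≠ south n := by
        rw [ae_iff]; simpa using hS0
      filter_upwards [hae] with x hx
      exact propext (hφlt (h x) t (hns x hx))
    rw [this, key]
  · intro x hx t ht
    have hx' := hns x hx
    obtain ⟨s', hs', hlt⟩ := exists_measure_lt σ h hcont.measurable h0
      ((hφlt (h x) t hx').1 ht)
    have hev : ∀ᶠ y in nhdsWithin x {south n}ᶜ, s' < h y :=
      (hcont.continuousAt.eventually_const_lt hs').filter_mono nhdsWithin_le_nhds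
    filter_upwards [hev, self_mem_nhdsWithin] with y hy hyS
    exact (hφlt (h y) t (hns y hyS)).2 (lt_of_le_of_lt (hAanti hy.le) hlt)
  · simp [hφ, h1, hσ]

/-- The symmetric decreasing rearrangement is unique. -/
theorem IsSymmetrization.unique (hn : 1 ≤ n) {f F G : USphere n → ℝ}
    (hF : IsSymmetrization f F) (hG : IsSymmetrization f G) : F = G := by
  have key : ∀ {F G : USphere n → ℝ}, IsSymmetrization f F → IsSymmetrization f G →
      ∀ x, G x ≤ F x := by
    intro F G hF hG x
    by_cases hxS : x = south n
    · rw [hxS, hF.south_eq, hG.south_eq]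
    by_contra! hlt
    obtain ⟨t, ht1, ht2⟩ := exists_between hlt
    obtain ⟨φ, hφ, hFφ⟩ := hF.radial
    obtain ⟨ψ, hψ, hGψ⟩ := hG.radial
    set h : USphere n → ℝ := fun x => dot x (north n) with hh
    have hcont : Continuous h := continuous_dot _
    have hFsub : {y | t < F y} ⊆ {y | h x < h y} := by
      intro y hy
      by_contra hle
      have : F y ≤ F x := by
        rw [hFφ, hFφ]; exact hφ (dot_mem_Icc _ _) (dot_mem_Icc _ _) (not_lt.1 hle)
      exact absurd (lt_of_lt_of_le hy this) (not_lt.2 ht1.le)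
    have hGup : ∀ y z, t < G y → h y ≤ h z → t < G z := by
      intro y z hy hyz
      refine lt_of_lt_of_le hy ?_
      rw [hGψ, hGψ]; exact hψ (dot_mem_Icc _ _) (dot_mem_Icc _ _) hyz
    have : PreconnectedSpace (USphere n) := by
      refine Subtype.preconnectedSpace (isPreconnected_sphere ?_ _ _)
      rw [← Module.finrank_eq_rank, finrank_euclideanSpace, Fintype.card_fin]
      exact_mod_cast (by omega : 1 < n + 1)
    have hSlt : ∀ y, y ≠ south n → h (south n) < h y := by
      intro y hy
      have h1 : h (south n) = -1 := dot_north_eq_neg_one.2 rfl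
      rw [h1]
      exact lt_of_le_of_ne (dot_mem_Icc y (north n)).1
        fun h' => hy (dot_north_eq_neg_one.1 h'.symm)
    obtain ⟨z, hzt, hzx⟩ : ∃ z, t < G z ∧ h z < h x := by
      by_contra! H
      have hset : {y | t < G y} = {y | h x ≤ h y} := by
        ext y
        exact ⟨fun hy => H y hy, fun hy => hGup x y ht2 hy⟩
      have hop : IsOpen {y | h x ≤ h y} := by
        rw [isOpen_iff_mem_nhds]
        intro y hy
        have hyS : y ≠ south n := by
          rintro rfl
          exact absurd hy (not_le.2 (hSlt x hxS))
        have hyt : t < G y := hGup x y ht2 hy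
        have := hG.lsc y hyS t hyt
        rw [nhdsWithin_eq_nhds.2 (isOpen_compl_singleton.mem_nhds hyS)] at this
        rw [← hset]; exact this
      have hcl : IsClopen {y | h x ≤ h y} := ⟨isClosed_le continuous_const hcont, hop⟩
      have huniv := hcl.eq_univ ⟨x, (le_refl (h x) : _)⟩
      have : south n ∈ {y | h x ≤ h y} := huniv ▸ mem_univ _
      exact absurd this (not_le.2 (hSlt x hxS))
    obtain ⟨s, hs1, hs2⟩ := exists_between hzx
    have hpos : 0 < surf n ({y | h z < h y} ∩ {y | h y < h x}) := by
      refine ((isOpen_lt continuous_const hcont).inter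
        (isOpen_lt hcont continuous_const)).measure_pos _ ?_
      obtain ⟨w, hw⟩ := mem_range_of_exists_le_of_exists_ge hcont ⟨z, hs1.le⟩ ⟨x, hs2.le⟩
      exact ⟨w, by simp only [mem_ofPred_eq, hw]; exact hs1,
        by simp only [mem_ofPred_eq, hw]; exact hs2⟩
    have hle : surf n {y | h x < h y} + surf n ({y | h z < h y} ∩ {y | h y < h x})
        ≤ surf n {y | t < G y} := by
      have hdis : Disjoint {y | h x < h y} ({y | h z < h y} ∩ {y | h y < h x}) := by
        rw [disjoint_left]; intro y hy hy'
        simp only [mem_ofPred_eq, mem_inter_iff] at hy hy'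
        linarith
      rw [← measure_union hdis (((isOpen_lt continuous_const hcont).inter
        (isOpen_lt hcont continuous_const)).measurableSet)]
      refine measure_mono ?_
      rintro y (hy | hy)
      · exact hGup z y hzt (hzx.le.trans (le_of_lt hy))
      · exact hGup z y hzt (le_of_lt hy.1)
    rw [← hG.measure_lt, hF.measure_lt] at hle
    have h2 := hle.trans (measure_mono hFsub)
    exact absurd h2 (not_le.2 (ENNReal.lt_add_right (measure_ne_top _ _) hpos.ne'))
  funext x
  exact le_antisymm (key hG hF x) (key hF hG x)

/-- The symmetric decreasing rearrangement `f*` of a continuous function `f` on `Sⁿ`, `n ≥ 1`: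
the unique function with the defining properties. -/
noncomputable def symmetrization (hn : 1 ≤ n) (f : C(USphere n, ℝ)) : USphere n → ℝ :=
  Classical.choose (exists_isSymmetrization hn f)

theorem isSymmetrization_symmetrization (hn : 1 ≤ n) (f : C(USphere n, ℝ)) :
    IsSymmetrization f (symmetrization hn f) :=
  Classical.choose_spec (exists_isSymmetrization hn f)

end USphere

/-! The method is two-point symmetrization. Polarizing both functions towards a half-space never
lowers the double integral (`rieszForm_le_polarize`), and raises it strictly if somewhere on that
half-space the reflection differences of `f` and `g` have opposite signs
(`mul_nonneg_of_rieszForm_polarize_eq`).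

The integral for the polarized pair is at most the one for `f*`, `g*`. Indeed, among pairs of
rearrangements of controlled modulus whose integral is at least the given one, a pair maximizing the
first moment towards the north pole is fixed by every polarization towards that pole, hence is `(f*,
g*)` (`exists_continuous_symmetrization`). Equality in the hypothesis thus forces equality for every
single polarization, so `f` and `g` are `ReflectionAligned`.

Rigidity comes from the moment vectors `a`, `b` of `f`, `g`. If `⟪a, v⟫ > 0`, then `f` strictly
prefers the side of `v` somewhere, so `g` prefers it everywhere and `⟪b, v⟫ ≥ 0`; hence `b` is a
positive multiple of `a`. Both functions are then polarized towards every half-space containing `a /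
‖a‖`, which makes them radially decreasing about it. That `a` and `b` are nonzero is where
non-constancy enters (`ReflectionAligned.exists_moment_ne_zero`). -/

namespace USphere

variable {n : ℕ}

/-! ### Reflections of the sphere -/

/-- The ambient Euclidean space of `Sⁿ`. -/
abbrev Ambient (n : ℕ) : Type := EuclideanSpace ℝ (Fin (n + 1))

/-- The reflection of the sphere in the hyperplane orthogonal to `v`. -/
noncomputable def refl (v : Ambient n) (x : USphere n) : USphere n :=
  ⟨(ℝ ∙ v)ᗮ.reflection (x : Ambient n), by simp⟩

theorem coe_refl (v : Ambient n) (x : USphere n) :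
    (refl v x : Ambient n) = (x : Ambient n) - (2 * inner ℝ (x : Ambient n) v / ‖v‖ ^ 2) • v := by
  have h : (refl v x : Ambient n) = (ℝ ∙ v)ᗮ.reflection (x : Ambient n) := rfl
  rw [h, Submodule.reflection_orthogonal_apply, Submodule.reflection_singleton_apply,
    real_inner_comm]
  simp only [RCLike.ofReal_real_eq_id, id, neg_sub, ← Nat.cast_smul_eq_nsmul ℝ, smul_smul]
  congr 2
  push_cast
  ring

theorem refl_refl (v : Ambient n) (x : USphere n) : refl v (refl v x) = x :=
  Subtype.ext (Submodule.reflection_reflection _ _)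

theorem continuous_refl (v : Ambient n) : Continuous (refl v) :=
  Continuous.subtype_mk (by fun_prop) _

theorem dist_refl_refl (v : Ambient n) (x y : USphere n) :
    dist (refl v x) (refl v y) = dist x y :=
  ((ℝ ∙ v)ᗮ.reflection).dist_map _ _

theorem dot_refl_refl (v : Ambient n) (x y : USphere n) : dot (refl v x) (refl v y) = dot x y :=
  ((ℝ ∙ v)ᗮ.reflection).inner_map_map _ _

theorem dot_refl_left (v : Ambient n) (x y : USphere n) : dot (refl v x) y = dot x (refl v y) := by
  rw [← dot_refl_refl v, refl_refl]

theorem inner_refl (v : Ambient n) (x : USphere n) :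
    inner ℝ (refl v x : Ambient n) v = -inner ℝ (x : Ambient n) v := by
  have h := ((ℝ ∙ v)ᗮ.reflection).inner_map_map (x : Ambient n) v
  rw [Submodule.reflection_orthogonalComplement_singleton_eq_neg, inner_neg_right] at h
  change inner ℝ ((ℝ ∙ v)ᗮ.reflection (x : Ambient n)) v = _
  linarith

theorem refl_eq_self {v : Ambient n} {x : USphere n} (h : inner ℝ (x : Ambient n) v = 0) :
    refl v x = x :=
  Subtype.ext (by rw [coe_refl, h]; simp)

/-- The sign depends only on whether `x` and `y` lie on the same side of the mirror; this is how the
monotonicity of the kernel enters. -/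
theorem dot_sub_dot_refl (v : Ambient n) (x y : USphere n) :
    dot x y - dot x (refl v y) =
      2 * (inner ℝ (x : Ambient n) v * inner ℝ (y : Ambient n) v) / ‖v‖ ^ 2 := by
  simp only [dot, coe_refl, inner_sub_right, inner_smul_right]
  ring

theorem refl_sub (x y : USphere n) : refl ((x : Ambient n) - (y : Ambient n)) x = y :=
  Subtype.ext (Submodule.reflection_sub (by simp))

theorem refl_smul {c : ℝ} (hc : c ≠ 0) (v : Ambient n) (x : USphere n) :
    refl (c • v) x = refl v x := by
  have : (ℝ ∙ (c • v)) = ℝ ∙ v := Submodule.span_singleton_smul_eq (IsUnit.mk0 c hc) v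
  simp only [refl, this]

theorem dist_le_dist_refl {v : Ambient n} {x y : USphere n}
    (h : 0 ≤ inner ℝ (x : Ambient n) v * inner ℝ (y : Ambient n) v) :
    dist x y ≤ dist x (refl v y) := by
  have hs : ∀ x y : USphere n, dist x y ^ 2 = 2 - 2 * dot x y := by
    intro x y
    rw [Subtype.dist_eq, dist_eq_norm, norm_sub_sq_real]
    simp [dot]
    ring
  have h1 := dot_sub_dot_refl v x y
  have h2 : 0 ≤ 2 * (inner ℝ (x : Ambient n) v * inner ℝ (y : Ambient n) v) / ‖v‖ ^ 2 := by
    positivity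
  refine le_of_sq_le_sq ?_ dist_nonneg
  rw [hs, hs]
  linarith

open scoped Pointwise in
-- Surface measure is, up to a constant factor, the volume of the cone over a set; the linear
-- reflection carries cones to cones and preserves volume.
theorem measurePreserving_refl (v : Ambient n) :
    MeasurePreserving (refl v) (surf n) (surf n) := by
  refine ⟨(continuous_refl v).measurable, ?_⟩
  ext s hs
  have hpre := (continuous_refl v).measurable hs
  rw [Measure.map_apply (continuous_refl v).measurable hs, surf, Measure.toSphere_apply' _ hs,
    Measure.toSphere_apply' _ hpre]
  congr 1
  have : Ioo (0 : ℝ) 1 • ((↑) '' (refl v ⁻¹' s)) =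
      (ℝ ∙ v)ᗮ.reflection ⁻¹' (Ioo (0 : ℝ) 1 • ((↑) '' s : Set (Ambient n))) := by
    ext z
    constructor
    · rintro ⟨r, hr, _, ⟨x, hx, rfl⟩, rfl⟩
      exact ⟨r, hr, _, ⟨refl v x, hx, rfl⟩, (map_smul _ _ _).symm⟩
    · rintro ⟨r, hr, _, ⟨x, hx, rfl⟩, hz⟩
      refine ⟨r, hr, _, ⟨refl v x, by rwa [mem_preimage, refl_refl], rfl⟩, ?_⟩
      rw [← (ℝ ∙ v)ᗮ.reflection_reflection z, ← hz]
      exact (map_smul (ℝ ∙ v)ᗮ.reflection r (x : Ambient n)).symm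
  rw [this]
  exact ((ℝ ∙ v)ᗮ.reflection).measurePreserving.measure_preimage_equiv
    (f := ((ℝ ∙ v)ᗮ.reflection).toMeasurableEquiv) _

theorem measurableEmbedding_refl (v : Ambient n) : MeasurableEmbedding (refl v) :=
  (Homeomorph.mk ⟨refl v, refl v, refl_refl v, refl_refl v⟩ (continuous_refl v)
    (continuous_refl v)).measurableEmbedding

theorem integral_comp_refl (v : Ambient n) (h : USphere n → ℝ) :
    ∫ x, h (refl v x) ∂surf n = ∫ x, h x ∂surf n :=
  (measurePreserving_refl v).integral_comp (measurableEmbedding_refl v) h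

theorem integrable_of_continuous {h : USphere n → ℝ} (hh : Continuous h) :
    Integrable h (surf n) :=
  hh.integrable_of_hasCompactSupport (HasCompactSupport.of_compactSpace h)

theorem integral_add_refl (v : Ambient n) {h : USphere n → ℝ} (hh : Continuous h) :
    ∫ x, (h x + h (refl v x)) ∂surf n = 2 * ∫ x, h x ∂surf n := by
  have h1 : ∫ x, (h x + h (refl v x)) ∂surf n = _ := integral_add (integrable_of_continuous hh)
    (integrable_of_continuous (hh.comp (continuous_refl v)))
  rw [h1, two_mul]
  exact congrArg _ (integral_comp_refl v h)

theorem eq_zero_of_integral_eq_zero {h : USphere n → ℝ} (hh : Continuous h) (h0 : ∀ x, 0 ≤ h x)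
    (hi : ∫ x, h x ∂surf n = 0) (x : USphere n) : h x = 0 := by
  by_contra hx
  exact (integral_pos_of_integrable_nonneg_nonzero hh (integrable_of_continuous hh) h0 hx).ne' hi

/-! ### Two-point symmetrization -/

/-- The polarization of `F` towards the half-space `0 ≤ ⟪·, v⟫`. -/
noncomputable def polarize (v : Ambient n) (F : C(USphere n, ℝ)) : C(USphere n, ℝ) where
  toFun x := if 0 ≤ inner ℝ (x : Ambient n) v then max (F x) (F (refl v x))
    else min (F x) (F (refl v x))
  continuous_toFun := by
    have h := continuous_refl v
    refine Continuous.if_le (by fun_prop) (by fun_prop) continuous_const (by fun_prop) ?_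
    -- The two branches agree on the mirror, because the reflection fixes its points.
    intro x hx
    rw [refl_eq_self hx.symm, max_self, min_self]

theorem polarize_of_nonneg {v : Ambient n} (F : C(USphere n, ℝ)) {x : USphere n}
    (h : 0 ≤ inner ℝ (x : Ambient n) v) : polarize v F x = max (F x) (F (refl v x)) :=
  if_pos h

theorem polarize_of_nonpos {v : Ambient n} (F : C(USphere n, ℝ)) {x : USphere n}
    (h : inner ℝ (x : Ambient n) v ≤ 0) : polarize v F x = min (F x) (F (refl v x)) := by
  rcases h.lt_or_eq with h | h
  · exact if_neg h.not_ge
  · rw [polarize_of_nonneg F h.ge, refl_eq_self h, max_self, min_self]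

theorem polarize_refl_of_nonneg {v : Ambient n} (F : C(USphere n, ℝ)) {x : USphere n}
    (h : 0 ≤ inner ℝ (x : Ambient n) v) : polarize v F (refl v x) = min (F x) (F (refl v x)) := by
  rw [polarize_of_nonpos F (by rw [inner_refl]; linarith), refl_refl, min_comm]

theorem polarize_refl_of_nonpos {v : Ambient n} (F : C(USphere n, ℝ)) {x : USphere n}
    (h : inner ℝ (x : Ambient n) v ≤ 0) : polarize v F (refl v x) = max (F x) (F (refl v x)) := by
  rw [polarize_of_nonneg F (by rw [inner_refl]; linarith), refl_refl, max_comm]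

/-- `F` is at least as large on the half-space `0 < ⟪·, v⟫` as at the reflected points. -/
def IsPolarized (F : C(USphere n, ℝ)) (v : Ambient n) : Prop :=
  ∀ x : USphere n, 0 < inner ℝ (x : Ambient n) v → F (refl v x) ≤ F x

/-- A polarization permutes the values at each pair of reflected points. -/
theorem comp_polarize_add (v : Ambient n) (F : C(USphere n, ℝ)) (φ : ℝ → ℝ) (x : USphere n) :
    φ (polarize v F x) + φ (polarize v F (refl v x)) = φ (F x) + φ (F (refl v x)) := by
  rcases le_total 0 (inner ℝ (x : Ambient n) v) with h | h
  · rw [polarize_of_nonneg F h, polarize_refl_of_nonneg F h]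
    rcases le_total (F x) (F (refl v x)) with h' | h' <;> simp [h', add_comm]
  · rw [polarize_of_nonpos F h, polarize_refl_of_nonpos F h]
    rcases le_total (F x) (F (refl v x)) with h' | h' <;> simp [h', add_comm]

theorem integral_comp_polarize (v : Ambient n) (F : C(USphere n, ℝ)) {φ : ℝ → ℝ}
    (hφ : Continuous φ) :
    ∫ x, φ (polarize v F x) ∂surf n = ∫ x, φ (F x) ∂surf n := by
  have h1 := integral_add_refl v (hφ.comp (polarize v F).continuous)
  have h2 := integral_add_refl v (hφ.comp F.continuous)
  simp only [Function.comp_apply, comp_polarize_add] at h1 h2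
  linarith

theorem abs_polarize_le {v : Ambient n} {F : C(USphere n, ℝ)} {M : ℝ} (hM : ∀ x, |F x| ≤ M)
    (x : USphere n) : |polarize v F x| ≤ M := by
  rcases le_total 0 (inner ℝ (x : Ambient n) v) with h | h
  · rw [polarize_of_nonneg F h]
    exact max_rec' (fun t => |t| ≤ M) (hM _) (hM _)
  · rw [polarize_of_nonpos F h]
    exact min_rec' (fun t => |t| ≤ M) (hM _) (hM _)

/-- Polarization does not increase the modulus of continuity. -/
theorem abs_polarize_sub_le {v : Ambient n} {F : C(USphere n, ℝ)} {δ ε : ℝ}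
    (hF : ∀ x y, dist x y ≤ δ → |F x - F y| ≤ ε) (x y : USphere n) (hxy : dist x y ≤ δ) :
    |polarize v F x - polarize v F y| ≤ ε := by
  have key : ∀ x y : USphere n, 0 ≤ inner ℝ (x : Ambient n) v → dist x y ≤ δ →
      |polarize v F x - polarize v F y| ≤ ε := by
    intro x y hx hxy
    have h1 := hF x y hxy
    have h2 := hF (refl v x) (refl v y) (by rwa [dist_refl_refl])
    rcases le_total 0 (inner ℝ (y : Ambient n) v) with hy | hy
    · rw [polarize_of_nonneg F hx, polarize_of_nonneg F hy]
      exact (abs_max_sub_max_le_max _ _ _ _).trans (max_le h1 h2)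
    -- `x` and `refl v y` lie on the same side, so they are at least as close as `x` and `y`. All
    -- four pairings of the two orbits are then controlled, whichever values the max and min select.
    · have h0 : dist x (refl v y) ≤ δ := by
        refine le_trans ?_ hxy
        have := dist_le_dist_refl (v := v) (x := x) (y := refl v y)
          (by rw [inner_refl]; nlinarith)
        rwa [refl_refl] at this
      have h3 := hF x (refl v y) h0
      have h4 := hF (refl v x) y (by rw [← dist_refl_refl v, refl_refl]; exact h0)
      rw [polarize_of_nonneg F hx, polarize_of_nonpos F hy]
      rcases max_cases (F x) (F (refl v x)) with h | h <;>
      rcases min_cases (F y) (F (refl v y)) with h' | h' <;>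
      rw [h.1, h'.1] <;> assumption
  rcases le_total 0 (inner ℝ (x : Ambient n) v) with hx | hx
  · exact key x y hx hxy
  rcases le_total 0 (inner ℝ (y : Ambient n) v) with hy | hy
  · rw [abs_sub_comm]
    exact key y x hy (by rwa [dist_comm])
  · rw [polarize_of_nonpos F hx, polarize_of_nonpos F hy]
    exact (abs_min_sub_min_le_max _ _ _ _).trans
      (max_le (hF x y hxy) (hF _ _ (by rwa [dist_refl_refl])))

/-! ### Functions polarized towards every half-space containing a point -/

/-- The reflection with normal `x - y` exchanges `x` and `y`, but `u` may lie on its mirror when the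
two dot products agree. Tilting the normal to `x - y + t • u` with `t > 0` puts `u` strictly inside,
and `t → 0` gives the claim by continuity. -/
theorem IsPolarized.le_of_dot_le {F : C(USphere n, ℝ)} {u : USphere n}
    (hF : ∀ v, 0 < inner ℝ (u : Ambient n) v → IsPolarized F v) {x y : USphere n}
    (hxy : dot y u ≤ dot x u) : F y ≤ F x := by
  rcases eq_or_ne x y with rfl | hne
  · rfl
  have hne' : (x : Ambient n) - y ≠ 0 := sub_ne_zero.2 fun h => hne (Subtype.ext h)
  set v : ℝ → Ambient n := fun t => (x : Ambient n) - y + t • (u : Ambient n) with hv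
  have hv0 : v 0 = (x : Ambient n) - y := by simp [hv]
  have hvc : Continuous v := by fun_prop
  have hx0 : 0 < inner ℝ (x : Ambient n) (v 0) := by
    rw [hv0]
    have h1 := norm_sub_sq_real (x : Ambient n) y
    have h2 : 0 < ‖(x : Ambient n) - y‖ := norm_pos_iff.2 hne'
    rw [inner_sub_right, real_inner_self_eq_norm_sq]
    simp only [norm_eq_of_mem_sphere] at h1 ⊢
    nlinarith
  have hlim : Filter.Tendsto (fun t => refl (v t) x) (nhdsWithin 0 (Ioi 0)) (nhds y) := by
    have : ContinuousAt (fun t => refl (v t) x) 0 := by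
      rw [Topology.IsInducing.subtypeVal.continuousAt_iff]
      have h0 : ‖v 0‖ ^ 2 ≠ 0 := by
        rw [hv0]
        exact pow_ne_zero _ (norm_ne_zero_iff.2 hne')
      simp only [Function.comp_def, coe_refl]
      fun_prop (disch := assumption)
    have h := this.tendsto
    simp only [hv0, refl_sub] at h
    exact h.mono_left nhdsWithin_le_nhds
  refine le_of_tendsto ((F.continuous.tendsto y).comp hlim) ?_
  have hev : ∀ᶠ t in nhdsWithin (0 : ℝ) (Ioi 0), 0 < inner ℝ (x : Ambient n) (v t) :=
    ((by fun_prop : Continuous fun t => inner ℝ (x : Ambient n) (v t)).continuousAt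
      |>.eventually_const_lt hx0).filter_mono nhdsWithin_le_nhds
  filter_upwards [hev, self_mem_nhdsWithin] with t ht ht0
  refine hF (v t) ?_ x ht
  have : inner ℝ (u : Ambient n) (v t) = dot x u - dot y u + t := by
    simp [hv, inner_add_right, inner_sub_right, inner_smul_right, dot, real_inner_comm]
  rw [this]
  have : 0 < t := ht0
  linarith

theorem isRadialDecreasing_of_isPolarized {F : C(USphere n, ℝ)} {u : USphere n}
    (hF : ∀ v, 0 < inner ℝ (u : Ambient n) v → IsPolarized F v) : IsRadialDecreasing F u := by
  have hbd : BddAbove (range F) := (isCompact_range F.continuous).bddAbove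
  refine ⟨fun t => sSup (F '' {x | dot x u ≤ t}), ?_, ?_⟩
  · intro s hs t ht hst
    refine csSup_le_csSup (hbd.mono (image_subset_range _ _)) ?_
      (image_mono fun x hx => le_trans hx hst)
    -- The antipode of `u` lies in every sublevel cap with `s ≥ -1`, so the supremum is over a
    -- nonempty set.
    refine ⟨F (-u), -u, ?_, rfl⟩
    have : dot (-u) u = -1 := by simp [dot]
    simpa [this] using hs.1
  · intro x
    have h : IsGreatest (F '' {y | dot y u ≤ dot x u}) (F x) := by
      refine ⟨⟨x, le_refl (dot x u), rfl⟩, ?_⟩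
      rintro _ ⟨y, hy, rfl⟩
      exact IsPolarized.le_of_dot_le hF hy
    exact h.csSup_eq.symm

/-! ### The double integral -/

/-- The functional `∬ K (x · y) F x G y` on the product of two spheres. -/
noncomputable def rieszForm (K : ℝ → ℝ) (F G : C(USphere n, ℝ)) : ℝ :=
  ∫ p : USphere n × USphere n, K (dot p.1 p.2) * F p.1 * G p.2 ∂(surf n).prod (surf n)

theorem continuous_dot_prod : Continuous fun p : USphere n × USphere n => dot p.1 p.2 := by
  unfold dot; fun_prop

theorem exists_abs_le (F : C(USphere n, ℝ)) : ∃ M, ∀ x, |F x| ≤ M := by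
  obtain ⟨M, hM⟩ := (isCompact_range F.continuous).isBounded.exists_norm_le
  exact ⟨M, fun x => hM _ ⟨x, rfl⟩⟩

theorem measurable_rieszForm_integrand {K : ℝ → ℝ} (hK : Monotone K) (F G : C(USphere n, ℝ)) :
    Measurable fun p : USphere n × USphere n => K (dot p.1 p.2) * F p.1 * G p.2 :=
  ((hK.measurable.comp continuous_dot_prod.measurable).mul
    (F.continuous.measurable.comp measurable_fst)).mul
    (G.continuous.measurable.comp measurable_snd)

theorem integrable_rieszForm {K : ℝ → ℝ} (hK : Monotone K) {C : ℝ} (hC : ∀ t, |K t| ≤ C)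
    (F G : C(USphere n, ℝ)) :
    Integrable (fun p : USphere n × USphere n => K (dot p.1 p.2) * F p.1 * G p.2)
      ((surf n).prod (surf n)) := by
  obtain ⟨M, hM⟩ := exists_abs_le F
  obtain ⟨M', hM'⟩ := exists_abs_le G
  refine Integrable.of_bound (measurable_rieszForm_integrand hK F G).aestronglyMeasurable
    (C * M * M') (Filter.Eventually.of_forall fun p => ?_)
  have hC0 : 0 ≤ C := (abs_nonneg _).trans (hC 0)
  have hM0 : 0 ≤ M := (abs_nonneg _).trans (hM p.1)
  rw [Real.norm_eq_abs, abs_mul, abs_mul]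
  gcongr
  exacts [hC _, hM _, hM' _]

theorem rieszForm_eq_integral_integral {K : ℝ → ℝ} (hK : Monotone K) {C : ℝ}
    (hC : ∀ t, |K t| ≤ C) (F G : C(USphere n, ℝ)) :
    rieszForm K F G = ∫ y, ∫ x, K (dot x y) * F x * G y ∂surf n ∂surf n :=
  integral_prod_symm _ (integrable_rieszForm hK hC F G)

/-- The sum of the integrand of `rieszForm` over the orbit of `(x, y)` under reflecting either
coordinate. -/
noncomputable def orbitSum (K : ℝ → ℝ) (v : Ambient n) (F G : C(USphere n, ℝ))
    (p : USphere n × USphere n) : ℝ :=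
  K (dot p.1 p.2) * (F p.1 * G p.2 + F (refl v p.1) * G (refl v p.2)) +
    K (dot p.1 (refl v p.2)) * (F p.1 * G (refl v p.2) + F (refl v p.1) * G p.2)

/-- Reflecting either coordinate preserves the product measure, so each of the four orbit terms has
the same integral. Inequalities for the form may therefore be checked orbit by orbit. -/
theorem integrable_orbitSum_and_integral {K : ℝ → ℝ} (hK : Monotone K) {C : ℝ}
    (hC : ∀ t, |K t| ≤ C) (v : Ambient n) (F G : C(USphere n, ℝ)) :
    Integrable (orbitSum K v F G) ((surf n).prod (surf n)) ∧
      ∫ p, orbitSum K v F G p ∂(surf n).prod (surf n) = 4 * rieszForm K F G := by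
  set H : USphere n × USphere n → ℝ := fun p => K (dot p.1 p.2) * F p.1 * G p.2 with hH
  have hi : Integrable H ((surf n).prod (surf n)) := integrable_rieszForm hK hC F G
  have hr := measurePreserving_refl v
  have hid := MeasurePreserving.id (surf n)
  have h1 := hid.prod hr
  have h2 := hr.prod hid
  have h3 := hr.prod hr
  have key : ∀ {T : USphere n × USphere n → USphere n × USphere n},
      MeasurePreserving T ((surf n).prod (surf n)) ((surf n).prod (surf n)) →
      Integrable (fun p => H (T p)) ((surf n).prod (surf n)) ∧
      ∫ p, H (T p) ∂(surf n).prod (surf n) = ∫ p, H p ∂(surf n).prod (surf n) := by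
    intro T hT
    refine ⟨hT.integrable_comp_of_integrable hi, ?_⟩
    rw [← integral_map hT.measurable.aemeasurable (by rw [hT.map_eq]; exact hi.1), hT.map_eq]
  have hsum : orbitSum K v F G = fun p => (H p + H (Prod.map (refl v) (refl v) p)) +
      (H (Prod.map id (refl v) p) + H (Prod.map (refl v) id p)) := by
    funext p
    simp only [orbitSum, hH, Prod.map_fst, Prod.map_snd, id, dot_refl_left, refl_refl]
    ring
  have ha := hi.add (key h3).1
  have hb := (key h1).1.add (key h2).1
  rw [hsum]
  refine ⟨ha.add hb, ?_⟩
  have e1 : ∫ p, ((H p + H (Prod.map (refl v) (refl v) p)) +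
      (H (Prod.map id (refl v) p) + H (Prod.map (refl v) id p))) ∂(surf n).prod (surf n) = _ :=
    integral_add ha hb
  have e2 : ∫ p, (H p + H (Prod.map (refl v) (refl v) p)) ∂(surf n).prod (surf n) = _ :=
    integral_add hi (key h3).1
  have e3 : ∫ p, (H (Prod.map id (refl v) p) + H (Prod.map (refl v) id p))
      ∂(surf n).prod (surf n) = _ := integral_add (key h1).1 (key h2).1
  rw [e1, e2, e3, (key h1).2, (key h2).2, (key h3).2]
  change _ = 4 * ∫ p, H p ∂(surf n).prod (surf n)
  ring

/-- The two sides agree if `a - b` and `c - d` have the same sign; otherwise the gain is `(A - B) *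
|a - b| * |c - d|`. -/
theorem rearrange_le {A B : ℝ} (hAB : B ≤ A) (a b c d : ℝ) :
    A * (a * c + b * d) + B * (a * d + b * c) ≤
      A * (max a b * max c d + min a b * min c d) +
        B * (max a b * min c d + min a b * max c d) := by
  rcases le_total a b with h | h <;> rcases le_total c d with h' | h' <;> simp only [h, h',
    max_eq_left, max_eq_right, min_eq_left, min_eq_right] <;>
  nlinarith [mul_nonneg (sub_nonneg.2 hAB) (mul_nonneg (sub_nonneg.2 h) (sub_nonneg.2 h'))]

theorem rearrange_lt {A B : ℝ} (hAB : B < A) {a b c d : ℝ} (h : (a - b) * (c - d) < 0) :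
    A * (a * c + b * d) + B * (a * d + b * c) <
      A * (max a b * max c d + min a b * min c d) +
        B * (max a b * min c d + min a b * max c d) := by
  have h1 := mul_pos (sub_pos.2 hAB) (neg_pos.2 h)
  rcases le_total a b with h2 | h2 <;> rcases le_total c d with h' | h' <;> simp only [h2, h',
    max_eq_left, max_eq_right, min_eq_left, min_eq_right] <;>
  nlinarith [mul_nonneg (sub_nonneg.2 h2) (sub_nonneg.2 h')]

theorem orbitSum_le {K : ℝ → ℝ} (hK : Monotone K) (v : Ambient n) (F G : C(USphere n, ℝ))
    (p : USphere n × USphere n) :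
    orbitSum K v F G p ≤ orbitSum K v (polarize v F) (polarize v G) p := by
  obtain ⟨x, y⟩ := p
  have hd := dot_sub_dot_refl v x y
  have hs : ∀ s : ℝ, 0 ≤ s → 0 ≤ 2 * s / ‖v‖ ^ 2 := fun s hs => by positivity
  have hs' : ∀ s : ℝ, s ≤ 0 → 2 * s / ‖v‖ ^ 2 ≤ 0 := fun s hs =>
    div_nonpos_of_nonpos_of_nonneg (by linarith) (by positivity)
  simp only [orbitSum]
  rcases le_total 0 (inner ℝ (x : Ambient n) v) with hx | hx <;>
  rcases le_total 0 (inner ℝ (y : Ambient n) v) with hy | hy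
  · have := hs _ (mul_nonneg hx hy)
    rw [polarize_of_nonneg F hx, polarize_refl_of_nonneg F hx, polarize_of_nonneg G hy,
      polarize_refl_of_nonneg G hy]
    exact rearrange_le (hK (by linarith)) _ _ _ _
  · have := hs' _ (mul_nonpos_of_nonneg_of_nonpos hx hy)
    rw [polarize_of_nonneg F hx, polarize_refl_of_nonneg F hx, polarize_of_nonpos G hy,
      polarize_refl_of_nonpos G hy]
    -- With `x` and `y` on opposite sides the larger kernel value sits at `(x, refl v y)`, so `y`
    -- and `refl v y` trade roles.
    have := rearrange_le (hK (by linarith : dot x y ≤ dot x (refl v y))) (F x) (F (refl v x))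
      (G (refl v y)) (G y)
    rw [max_comm (G (refl v y)), min_comm (G (refl v y))] at this
    linarith
  · have := hs' _ (mul_nonpos_of_nonpos_of_nonneg hx hy)
    rw [polarize_of_nonpos F hx, polarize_refl_of_nonpos F hx, polarize_of_nonneg G hy,
      polarize_refl_of_nonneg G hy]
    have := rearrange_le (hK (by linarith : dot x y ≤ dot x (refl v y))) (F x) (F (refl v x))
      (G (refl v y)) (G y)
    rw [max_comm (G (refl v y)), min_comm (G (refl v y))] at this
    linarith
  · have := hs _ (mul_nonneg_of_nonpos_of_nonpos hx hy)
    rw [polarize_of_nonpos F hx, polarize_refl_of_nonpos F hx, polarize_of_nonpos G hy,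
      polarize_refl_of_nonpos G hy]
    have := rearrange_le (hK (by linarith : dot x (refl v y) ≤ dot x y)) (F x) (F (refl v x))
      (G y) (G (refl v y))
    linarith

theorem orbitSum_lt {K : ℝ → ℝ} (hK : StrictMonoOn K (Icc (-1) 1)) {v : Ambient n}
    {F G : C(USphere n, ℝ)} {x y : USphere n} (hx : 0 < inner ℝ (x : Ambient n) v)
    (hy : 0 < inner ℝ (y : Ambient n) v)
    (h : (F x - F (refl v x)) * (G y - G (refl v y)) < 0) :
    orbitSum K v F G (x, y) < orbitSum K v (polarize v F) (polarize v G) (x, y) := by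
  have hd := dot_sub_dot_refl v x y
  have hv : v ≠ 0 := by rintro rfl; simp at hx
  have : 0 < 2 * (inner ℝ (x : Ambient n) v * inner ℝ (y : Ambient n) v) / ‖v‖ ^ 2 := by
    have := norm_pos_iff.2 hv
    positivity
  simp only [orbitSum]
  rw [polarize_of_nonneg F hx.le, polarize_refl_of_nonneg F hx.le, polarize_of_nonneg G hy.le,
    polarize_refl_of_nonneg G hy.le]
  exact rearrange_lt (hK (dot_mem_Icc _ _) (dot_mem_Icc _ _) (by linarith)) h

/-- Polarizing both functions does not decrease `rieszForm`. -/
theorem rieszForm_le_polarize {K : ℝ → ℝ} (hK : Monotone K) {C : ℝ} (hC : ∀ t, |K t| ≤ C)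
    (v : Ambient n) (F G : C(USphere n, ℝ)) :
    rieszForm K F G ≤ rieszForm K (polarize v F) (polarize v G) := by
  obtain ⟨h1, h2⟩ := integrable_orbitSum_and_integral hK hC v F G
  obtain ⟨h3, h4⟩ := integrable_orbitSum_and_integral hK hC v (polarize v F) (polarize v G)
  have := integral_mono h1 h3 (orbitSum_le hK v F G)
  linarith

/-- Equal integrals of ordered orbit sums force equality almost everywhere. By continuity a single
bad pair would yield a nonempty open set of strict inequality, which has positive measure. -/
theorem mul_nonneg_of_rieszForm_polarize_eq {K : ℝ → ℝ} (hK : Monotone K)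
    (hKs : StrictMonoOn K (Icc (-1) 1)) {C : ℝ} (hC : ∀ t, |K t| ≤ C)
    {v : Ambient n} {F G : C(USphere n, ℝ)}
    (heq : rieszForm K F G = rieszForm K (polarize v F) (polarize v G))
    {x y : USphere n} (hx : 0 < inner ℝ (x : Ambient n) v)
    (hy : 0 < inner ℝ (y : Ambient n) v) :
    0 ≤ (F x - F (refl v x)) * (G y - G (refl v y)) := by
  obtain ⟨h1, h2⟩ := integrable_orbitSum_and_integral hK hC v F G
  obtain ⟨h3, h4⟩ := integrable_orbitSum_and_integral hK hC v (polarize v F) (polarize v G)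
  by_contra! hneg
  set U : Set (USphere n × USphere n) := {p | 0 < inner ℝ (p.1 : Ambient n) v ∧
    0 < inner ℝ (p.2 : Ambient n) v ∧
    (F p.1 - F (refl v p.1)) * (G p.2 - G (refl v p.2)) < 0} with hU
  have hr := continuous_refl v
  have o1 : IsOpen {p : USphere n × USphere n | 0 < inner ℝ (p.1 : Ambient n) v} :=
    isOpen_lt continuous_const (by fun_prop)
  have o2 : IsOpen {p : USphere n × USphere n | 0 < inner ℝ (p.2 : Ambient n) v} :=
    isOpen_lt continuous_const (by fun_prop)
  have o3 : IsOpen {p : USphere n × USphere n |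
      (F p.1 - F (refl v p.1)) * (G p.2 - G (refl v p.2)) < 0} :=
    isOpen_lt (by fun_prop) continuous_const
  have hUo : IsOpen U := o1.inter (o2.inter o3)
  have hUpos : 0 < (surf n).prod (surf n) U := hUo.measure_pos _ ⟨(x, y), hx, hy, hneg⟩
  have hae := (integral_eq_iff_of_ae_le h1 h3
    (Filter.Eventually.of_forall (orbitSum_le hK v F G))).1 (by linarith)
  have hnull : (surf n).prod (surf n) U = 0 := by
    refine measure_mono_null ?_ hae
    rintro ⟨x, y⟩ ⟨hx, hy, h⟩
    exact (orbitSum_lt hKs hx hy h).ne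
  exact hUpos.ne' hnull

/-! ### A compact class of rearrangements -/

/-- The continuous functions with the same distribution as `f` whose bound and modulus of
continuity are no worse than those of `f`. -/
def rearrangements (f : C(USphere n, ℝ)) : Set C(USphere n, ℝ) :=
  {F | (∀ M : ℝ, (∀ x, |f x| ≤ M) → ∀ x, |F x| ≤ M) ∧
    (∀ δ ε : ℝ, (∀ x y, dist x y ≤ δ → |f x - f y| ≤ ε) → ∀ x y, dist x y ≤ δ →
      |F x - F y| ≤ ε) ∧
    ∀ φ : BoundedContinuousFunction ℝ ℝ, ∫ x, φ (F x) ∂surf n = ∫ x, φ (f x) ∂surf n}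

theorem self_mem_rearrangements (f : C(USphere n, ℝ)) : f ∈ rearrangements f :=
  ⟨fun _ h => h, fun _ _ h => h, fun _ => rfl⟩

theorem polarize_mem_rearrangements {f F : C(USphere n, ℝ)} (hF : F ∈ rearrangements f)
    (v : Ambient n) : polarize v F ∈ rearrangements f :=
  ⟨fun M h => abs_polarize_le (hF.1 M h), fun δ ε h => abs_polarize_sub_le (hF.2.1 δ ε h),
    fun φ => (integral_comp_polarize v F φ.continuous).trans (hF.2.2 φ)⟩

theorem isClosed_rearrangements (f : C(USphere n, ℝ)) : IsClosed (rearrangements f) := by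
  have hev : ∀ x, Continuous fun F : C(USphere n, ℝ) => F x := continuous_eval_const
  have h1 : IsClosed {F : C(USphere n, ℝ) | ∀ M : ℝ, (∀ x, |f x| ≤ M) → ∀ x, |F x| ≤ M} := by
    simp only [ofPred_forall]
    refine isClosed_iInter fun M => isClosed_iInter fun _ => isClosed_iInter fun x => ?_
    exact isClosed_le (hev x).abs continuous_const
  have h2 : IsClosed {F : C(USphere n, ℝ) | ∀ δ ε : ℝ,
      (∀ x y, dist x y ≤ δ → |f x - f y| ≤ ε) → ∀ x y, dist x y ≤ δ → |F x - F y| ≤ ε} := by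
    simp only [ofPred_forall]
    refine isClosed_iInter fun δ => isClosed_iInter fun ε => isClosed_iInter fun _ =>
      isClosed_iInter fun x => isClosed_iInter fun y => isClosed_iInter fun _ => ?_
    exact isClosed_le ((hev x).sub (hev y)).abs continuous_const
  have h3 : IsClosed {F : C(USphere n, ℝ) | ∀ φ : BoundedContinuousFunction ℝ ℝ,
      ∫ x, φ (F x) ∂surf n = ∫ x, φ (f x) ∂surf n} := by
    simp only [ofPred_forall]
    refine isClosed_iInter fun φ => isClosed_eq ?_ continuous_const
    refine continuous_of_dominated (bound := fun _ => ‖φ‖)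
      (fun F => (φ.continuous.comp F.continuous).aestronglyMeasurable)
      (fun F => Filter.Eventually.of_forall fun x => φ.norm_coe_le_norm _) (integrable_const _)
      (Filter.Eventually.of_forall fun x => φ.continuous.comp (hev x))
  exact h1.inter (h2.inter h3)

/-- Arzelà–Ascoli: the class is closed, and all its members share the bound and the modulus of
continuity of `f`. -/
theorem isCompact_rearrangements (f : C(USphere n, ℝ)) : IsCompact (rearrangements f) := by
  obtain ⟨M, hM⟩ := exists_abs_le f
  set e := ContinuousMap.isometryEquivBoundedOfCompact (USphere n) ℝ with he
  have hc : IsCompact (e.symm ⁻¹' rearrangements f) := by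
    refine BoundedContinuousFunction.arzela_ascoli₂ (Icc (-M) M) isCompact_Icc _
      ((isClosed_rearrangements f).preimage e.symm.continuous)
      (fun F x hF => abs_le.1 (hF.1 M hM x)) ?_
    intro x
    rw [Metric.equicontinuousAt_iff]
    intro ε hε
    obtain ⟨δ, hδ, h⟩ := Metric.uniformContinuous_iff.1
      (CompactSpace.uniformContinuous_of_continuous f.continuous) (ε / 2) (by positivity)
    -- The class records non-strict moduli, so both constants are halved to meet the strict
    -- inequalities of uniform continuity and equicontinuity.
    refine ⟨δ / 2, by positivity, fun y hy F => ?_⟩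
    have h1 := F.2.2.1 (δ / 2) (ε / 2) (fun x y hxy => (h (by linarith)).le) x y
      (by rw [dist_comm]; exact hy.le)
    change |(F : BoundedContinuousFunction (USphere n) ℝ) x -
      (F : BoundedContinuousFunction (USphere n) ℝ) y| < ε
    exact lt_of_le_of_lt h1 (by linarith)
  exact (e.symm.toHomeomorph.isCompact_preimage).1 hc

theorem continuousOn_rieszForm {K : ℝ → ℝ} (hK : Monotone K) {C : ℝ} (hC : ∀ t, |K t| ≤ C)
    (f g : C(USphere n, ℝ)) :
    ContinuousOn (fun p : C(USphere n, ℝ) × C(USphere n, ℝ) => rieszForm K p.1 p.2)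
      (rearrangements f ×ˢ rearrangements g) := by
  obtain ⟨M, hM⟩ := exists_abs_le f
  obtain ⟨M', hM'⟩ := exists_abs_le g
  have hev : ∀ x, Continuous fun F : C(USphere n, ℝ) => F x := continuous_eval_const
  refine continuousOn_of_dominated (bound := fun _ => C * M * M')
    (fun p _ => (measurable_rieszForm_integrand hK p.1 p.2).aestronglyMeasurable) ?_
    (integrable_const _) (Filter.Eventually.of_forall fun q => Continuous.continuousOn ?_)
  · refine fun p hp => Filter.Eventually.of_forall fun q => ?_
    have hC0 : 0 ≤ C := (abs_nonneg _).trans (hC 0)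
    have hM0 : 0 ≤ M := (abs_nonneg _).trans (hM q.1)
    rw [Real.norm_eq_abs, abs_mul, abs_mul]
    gcongr
    exacts [hC _, hp.1.1 M hM _, hp.2.1 M' hM' _]
  · exact (continuous_const.mul ((hev q.1).comp continuous_fst)).mul
      ((hev q.2).comp continuous_snd)

/-! ### First moments and their growth under polarization -/

/-- The first moment of `F` in the direction `v`. -/
noncomputable def moment (F : C(USphere n, ℝ)) (v : Ambient n) : ℝ :=
  ∫ x, F x * inner ℝ (x : Ambient n) v ∂surf n

theorem continuous_moment_integrand (F : C(USphere n, ℝ)) (v : Ambient n) :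
    Continuous fun x : USphere n => F x * inner ℝ (x : Ambient n) v := by fun_prop

theorem continuousOn_moment (f : C(USphere n, ℝ)) (v : Ambient n) :
    ContinuousOn (fun F : C(USphere n, ℝ) => moment F v) (rearrangements f) := by
  obtain ⟨M, hM⟩ := exists_abs_le f
  refine continuousOn_of_dominated (bound := fun _ => M * ‖v‖)
    (fun F _ => (continuous_moment_integrand F v).aestronglyMeasurable) ?_
    (integrable_const _) (Filter.Eventually.of_forall fun x => Continuous.continuousOn ?_)
  · refine fun F hF => Filter.Eventually.of_forall fun x => ?_
    rw [norm_mul]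
    have h1 := norm_inner_le_norm (𝕜 := ℝ) (x : Ambient n) v
    rw [norm_eq_of_mem_sphere, one_mul] at h1
    exact mul_le_mul (hF.1 M hM x) h1 (norm_nonneg _) ((abs_nonneg _).trans (hM x))
  · exact (continuous_eval_const x).mul continuous_const

theorem inner_sub_inner_refl (u v : Ambient n) (x : USphere n) :
    inner ℝ (x : Ambient n) u - inner ℝ (refl v x : Ambient n) u =
      2 * (inner ℝ (x : Ambient n) v * inner ℝ u v) / ‖v‖ ^ 2 := by
  rw [coe_refl, inner_sub_left, real_inner_smul_left, real_inner_comm u v]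
  ring

/-- Polarization keeps the sum over each reflected pair, so its changes at the two points are
opposite. Pairing them leaves the change at `x` times the difference of the two weights, a product
that is nonnegative when `⟪u, v⟫ > 0`. -/
theorem two_mul_moment_polarize_sub (F : C(USphere n, ℝ)) (u v : Ambient n) :
    2 * (moment (polarize v F) u - moment F u) =
      ∫ x, (polarize v F x - F x) *
        (2 * (inner ℝ (x : Ambient n) v * inner ℝ u v) / ‖v‖ ^ 2) ∂surf n := by
  have hr := continuous_refl v
  have h1 := integral_add_refl v (continuous_moment_integrand (polarize v F) u)
  have h2 := integral_add_refl v (continuous_moment_integrand F u)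
  rw [mul_sub]
  unfold moment
  rw [← h1, ← h2, ← integral_sub (integrable_of_continuous (by fun_prop))
    (integrable_of_continuous (by fun_prop))]
  congr 1
  funext x
  rw [← inner_sub_inner_refl]
  have := comp_polarize_add v F id x
  simp only [id] at this
  linear_combination (inner ℝ (refl v x : Ambient n) u) * this

theorem polarize_sub_mul_nonneg (F : C(USphere n, ℝ)) {u v : Ambient n}
    (huv : 0 < inner ℝ u v) (x : USphere n) :
    0 ≤ (polarize v F x - F x) *
      (2 * (inner ℝ (x : Ambient n) v * inner ℝ u v) / ‖v‖ ^ 2) := by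
  rcases le_total 0 (inner ℝ (x : Ambient n) v) with h | h
  · rw [polarize_of_nonneg F h]
    exact mul_nonneg (sub_nonneg.2 (le_max_left _ _)) (by positivity)
  · rw [polarize_of_nonpos F h]
    refine mul_nonneg_of_nonpos_of_nonpos (sub_nonpos.2 (min_le_left _ _))
      (div_nonpos_of_nonpos_of_nonneg ?_ (by positivity))
    have := mul_nonpos_of_nonpos_of_nonneg h huv.le
    linarith

theorem moment_le_moment_polarize (F : C(USphere n, ℝ)) {u v : Ambient n}
    (huv : 0 < inner ℝ u v) : moment F u ≤ moment (polarize v F) u := by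
  have h : 0 ≤ 2 * (moment (polarize v F) u - moment F u) := by
    rw [two_mul_moment_polarize_sub]
    exact integral_nonneg (polarize_sub_mul_nonneg F huv)
  linarith

/-- The equality case: a continuous nonnegative integrand of integral zero vanishes everywhere, so
polarization changes nothing off the mirror. -/
theorem isPolarized_of_moment_le (F : C(USphere n, ℝ)) {u v : Ambient n}
    (huv : 0 < inner ℝ u v) (h : moment (polarize v F) u ≤ moment F u) : IsPolarized F v := by
  have h1 := two_mul_moment_polarize_sub F u v
  have h2 := moment_le_moment_polarize F huv
  intro x hx
  have h3 := eq_zero_of_integral_eq_zero (by fun_prop) (polarize_sub_mul_nonneg F huv)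
    (by linarith) x
  have hv : 0 < ‖v‖ := norm_pos_iff.2 (by rintro rfl; simp at hx)
  have h4 : 0 < 2 * (inner ℝ (x : Ambient n) v * inner ℝ u v) / ‖v‖ ^ 2 := by positivity
  have h5 := (mul_eq_zero.1 h3).resolve_right h4.ne'
  rw [polarize_of_nonneg F hx.le] at h5
  have := le_max_right (F x) (F (refl v x))
  linarith

/-! ### Symmetrizations as moment maximizers -/

/-- Integrals of bounded continuous functions determine the distribution, so `F` and `f` share it.
As nonempty open sets have positive measure, the essential infimum is the minimum of `F`, attained
at the south pole. -/
theorem isSymmetrization_of_mem_rearrangements {f F : C(USphere n, ℝ)}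
    (hF : F ∈ rearrangements f) (hr : IsRadialDecreasing F (north n)) :
    IsSymmetrization f F := by
  have hmap : (surf n).map F = (surf n).map f := by
    refine ext_of_forall_integral_eq_of_IsFiniteMeasure fun φ => ?_
    rw [integral_map F.continuous.aemeasurable φ.continuous.aestronglyMeasurable,
      integral_map f.continuous.aemeasurable φ.continuous.aestronglyMeasurable, hF.2.2 φ]
  have hpre : ∀ s : Set ℝ, MeasurableSet s → surf n (F ⁻¹' s) = surf n (f ⁻¹' s) := by
    intro s hs
    rw [← Measure.map_apply F.continuous.measurable hs, hmap,
      Measure.map_apply f.continuous.measurable hs]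
  refine ⟨hr, fun t => (hpre _ measurableSet_Ioi).symm,
    F.continuous.lowerSemicontinuous.lowerSemicontinuousOn _, ?_⟩
  obtain ⟨φ, hφ, hFφ⟩ := hr
  have hmin : ∀ x, F (south n) ≤ F x := by
    intro x
    rw [hFφ, hFφ]
    refine hφ (dot_mem_Icc _ _) (dot_mem_Icc _ _) ?_
    rw [dot_north_eq_neg_one.2 rfl]
    exact (dot_mem_Icc _ _).1
  rw [essInf_eq_sSup]
  have : {a | surf n {x | f x < a} = 0} = Iic (F (south n)) := by
    ext a
    have h1 : surf n {x | f x < a} = surf n {x | F x < a} := (hpre _ measurableSet_Iio).symm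
    rw [mem_ofPred_eq, h1, mem_Iic]
    constructor
    · intro h
      by_contra! hlt
      exact ((isOpen_lt F.continuous continuous_const).measure_pos (surf n) ⟨south n, hlt⟩).ne' h
    · intro h
      have : {x | F x < a} = ∅ := by
        ext x
        simpa using h.trans (hmin x)
      rw [this, measure_empty]
  rw [this, csSup_Iic]

/-- The spherical rearrangement inequality, together with the continuity of the symmetrizations. -/
theorem exists_continuous_symmetrization (hn : 1 ≤ n) {K : ℝ → ℝ} (hK : Monotone K) {C : ℝ}
    (hC : ∀ t, |K t| ≤ C) {f g f' g' : C(USphere n, ℝ)} (hf' : f' ∈ rearrangements f)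
    (hg' : g' ∈ rearrangements g) :
    ∃ F G : C(USphere n, ℝ), symmetrization hn f = F ∧ symmetrization hn g = G ∧
      rieszForm K f' g' ≤ rieszForm K F G := by
  set A := rearrangements f ×ˢ rearrangements g with hA
  -- This superlevel set is compact and stable under simultaneous polarization, so a moment
  -- maximizer exists in it and can be compared with its own polarizations.
  set B := {p | p ∈ A ∧ rieszForm K f' g' ≤ rieszForm K p.1 p.2} with hB
  have hAc : IsCompact A := (isCompact_rearrangements f).prod (isCompact_rearrangements g)
  have hBc : IsCompact B := by
    refine hAc.of_isClosed_subset ?_ fun p hp => hp.1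
    exact (continuousOn_rieszForm hK hC f g).preimage_isClosed_of_isClosed hAc.isClosed
      (isClosed_Ici (a := rieszForm K f' g'))
  set N : Ambient n := (north n : Ambient n) with hN
  have hJ : ContinuousOn (fun p : C(USphere n, ℝ) × C(USphere n, ℝ) =>
      moment p.1 N + moment p.2 N) B :=
    ((continuousOn_moment f N).comp continuous_fst.continuousOn fun p hp => hp.1.1).add
      ((continuousOn_moment g N).comp continuous_snd.continuousOn fun p hp => hp.1.2)
  obtain ⟨⟨F, G⟩, ⟨⟨hF, hG⟩, hle⟩, hmax⟩ := hBc.exists_isMaxOn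
    ⟨(f', g'), ⟨hf', hg'⟩, le_refl _⟩ hJ
  have hpol : ∀ v, 0 < inner ℝ N v → IsPolarized F v ∧ IsPolarized G v := by
    intro v hv
    have h : (polarize v F, polarize v G) ∈ B :=
      ⟨⟨polarize_mem_rearrangements hF v, polarize_mem_rearrangements hG v⟩,
        hle.trans (rieszForm_le_polarize hK hC v F G)⟩
    have h1 : moment (polarize v F) N + moment (polarize v G) N ≤ moment F N + moment G N :=
      hmax h
    have h2 := moment_le_moment_polarize F hv
    have h3 := moment_le_moment_polarize G hv
    -- Neither moment decreases while their sum cannot increase, so each one is unchanged.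
    exact ⟨isPolarized_of_moment_le F hv (by linarith),
      isPolarized_of_moment_le G hv (by linarith)⟩
  have hFr := isRadialDecreasing_of_isPolarized fun v hv => (hpol v hv).1
  have hGr := isRadialDecreasing_of_isPolarized fun v hv => (hpol v hv).2
  exact ⟨F, G,
    (isSymmetrization_symmetrization hn f).unique hn
      (isSymmetrization_of_mem_rearrangements hF hFr),
    (isSymmetrization_symmetrization hn g).unique hn
      (isSymmetrization_of_mem_rearrangements hG hGr),
    hle⟩

/-! ### Rigidity -/

theorem two_mul_moment (F : C(USphere n, ℝ)) (v : Ambient n) :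
    2 * moment F v =
      ∫ x, (F x - F (refl v x)) * inner ℝ (x : Ambient n) v ∂surf n := by
  unfold moment
  rw [← integral_add_refl v (continuous_moment_integrand F v)]
  congr 1
  funext x
  rw [inner_refl]
  ring

/-- Otherwise the reflection difference times `⟪x, v⟫` would be nonpositive everywhere, and so would
the moment. -/
theorem exists_lt_of_moment_pos {F : C(USphere n, ℝ)} {v : Ambient n} (h : 0 < moment F v) :
    ∃ x : USphere n, 0 < inner ℝ (x : Ambient n) v ∧ F (refl v x) < F x := by
  by_contra! H
  have h1 := two_mul_moment F v
  have h2 : ∫ x, (F x - F (refl v x)) * inner ℝ (x : Ambient n) v ∂surf n ≤ 0 := by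
    refine integral_nonpos fun x => ?_
    rcases lt_trichotomy 0 (inner ℝ (x : Ambient n) v) with hx | hx | hx
    · exact mul_nonpos_of_nonpos_of_nonneg (sub_nonpos.2 (H x hx)) hx.le
    · simp [← hx]
    · have := H (refl v x) (by rw [inner_refl]; linarith)
      rw [refl_refl] at this
      exact mul_nonpos_of_nonneg_of_nonpos (sub_nonneg.2 this) hx.le
  linarith

theorem IsPolarized.sub_mul_nonneg {F : C(USphere n, ℝ)} {v : Ambient n} (hF : IsPolarized F v)
    (x : USphere n) : 0 ≤ (F x - F (refl v x)) * inner ℝ (x : Ambient n) v := by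
  rcases lt_trichotomy 0 (inner ℝ (x : Ambient n) v) with hx | hx | hx
  · exact mul_nonneg (sub_nonneg.2 (hF x hx)) hx.le
  · simp [← hx]
  · have := hF (refl v x) (by rw [inner_refl]; linarith)
    rw [refl_refl] at this
    exact mul_nonneg_of_nonpos_of_nonpos (sub_nonpos.2 this) hx.le

theorem IsPolarized.moment_nonneg {F : C(USphere n, ℝ)} {v : Ambient n} (hF : IsPolarized F v) :
    0 ≤ moment F v := by
  have h : 0 ≤ 2 * moment F v := by
    rw [two_mul_moment]
    exact integral_nonneg hF.sub_mul_nonneg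
  linarith

theorem IsPolarized.comp_refl_eq {F : C(USphere n, ℝ)} {v : Ambient n} (hF : IsPolarized F v)
    (h : moment F v = 0) (x : USphere n) : F (refl v x) = F x := by
  have hr := continuous_refl v
  have h1 := two_mul_moment F v
  have h2 := eq_zero_of_integral_eq_zero (by fun_prop) hF.sub_mul_nonneg (by linarith) x
  rcases mul_eq_zero.1 h2 with h3 | h3
  · linarith
  · rw [refl_eq_self h3]

/-- A continuous function invariant under an open set of reflections is constant. -/
theorem exists_eq_const_of_comp_refl_eq (hn : 1 ≤ n) {F : C(USphere n, ℝ)} {U : Set (Ambient n)}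
    (hU : IsOpen U) (hne : U.Nonempty) (h : ∀ v ∈ U, ∀ x, F (refl v x) = F x) :
    ∃ c : ℝ, ∀ x, F x = c := by
  have hconn : PreconnectedSpace (USphere n) := by
    refine Subtype.preconnectedSpace (isPreconnected_sphere ?_ _ _)
    rw [← Module.finrank_eq_rank, finrank_euclideanSpace, Fintype.card_fin]
    exact_mod_cast (by omega : 1 < n + 1)
  have hloc : IsLocallyConstant F := by
    rw [IsLocallyConstant.iff_eventually_eq]
    intro z
    obtain ⟨v, hvU, hv⟩ : ∃ v ∈ U, inner ℝ (z : Ambient n) v ≠ 0 := by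
      obtain ⟨v, hv⟩ := hne
      -- The reflection must move `z`; a normal orthogonal to `z` is nudged along `z` within the
      -- open set.
      by_cases hz : inner ℝ (z : Ambient n) v = 0
      · have hc : Continuous fun t : ℝ => v + t • (z : Ambient n) := by fun_prop
        have hev : ∀ᶠ t in nhdsWithin (0 : ℝ) (Ioi 0), v + t • (z : Ambient n) ∈ U :=
          (hc.continuousAt.eventually_mem (hU.mem_nhds (by simpa using hv))).filter_mono
            nhdsWithin_le_nhds
        obtain ⟨t, ht, ht0⟩ := (hev.and self_mem_nhdsWithin).exists
        refine ⟨_, ht, ?_⟩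
        rw [inner_add_right, hz, inner_smul_right, real_inner_self_eq_norm_sq,
          norm_eq_of_mem_sphere]
        simpa using (ne_of_gt ht0)
      · exact ⟨v, hv, hz⟩
    have hv0 : ‖v‖ ≠ 0 := norm_ne_zero_iff.2 (by rintro rfl; simp at hv)
    set c : ℝ := 2 * inner ℝ (z : Ambient n) v / ‖v‖ ^ 2 with hc
    have hc0 : c ≠ 0 := div_ne_zero (mul_ne_zero two_ne_zero hv) (pow_ne_zero _ hv0)
    set x := refl v z with hx
    -- Every `z'` near `z` can also be reflected to `x`: a suitable normal is a multiple of `z' -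
    -- x`, and the factor `c⁻¹` makes it equal `v` at `z' = z`, hence lie in `U` nearby. So `F z' =
    -- F x = F z`.
    have hcont : Continuous fun z' : USphere n => c⁻¹ • ((z' : Ambient n) - (x : Ambient n)) := by
      fun_prop
    have hz : c⁻¹ • ((z : Ambient n) - (x : Ambient n)) = v := by
      rw [hx, coe_refl, sub_sub_cancel, smul_smul, inv_mul_cancel₀ hc0, one_smul]
    filter_upwards [hcont.continuousAt.eventually_mem
      (hU.mem_nhds (show c⁻¹ • ((z : Ambient n) - (x : Ambient n)) ∈ U by rwa [hz]))] with z' hz'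
    rw [← h _ hz' z', refl_smul (inv_ne_zero hc0), refl_sub, hx, h v hvU]
  exact ⟨F (north n), fun x => hloc.apply_eq_of_preconnectedSpace _ _⟩

/-- On each half-space, the differences of `f` and of `g` under the reflection have the same
sign. -/
def ReflectionAligned (f g : C(USphere n, ℝ)) : Prop :=
  ∀ (v : Ambient n) (x y : USphere n), 0 < inner ℝ (x : Ambient n) v →
    0 < inner ℝ (y : Ambient n) v → 0 ≤ (f x - f (refl v x)) * (g y - g (refl v y))

theorem ReflectionAligned.symm {f g : C(USphere n, ℝ)} (h : ReflectionAligned f g) :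
    ReflectionAligned g f := fun v x y hx hy => by
  rw [mul_comm]
  exact h v y x hy hx

theorem ReflectionAligned.isPolarized {f g : C(USphere n, ℝ)} (h : ReflectionAligned f g)
    {v : Ambient n} {y : USphere n} (hy : 0 < inner ℝ (y : Ambient n) v)
    (hlt : g (refl v y) < g y) : IsPolarized f v := fun x hx =>
  sub_nonneg.1 (nonneg_of_mul_nonneg_left (h v x y hx hy) (sub_pos.2 hlt))

/-- If `g z < g y`, the reflection with normal `y - z` lowers `g` at `y`, and so do those with
nearby normals; hence `f` is polarized for an open set of normals. Vanishing moments would make `f`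
invariant under all these reflections, hence constant. -/
theorem ReflectionAligned.exists_moment_ne_zero (hn : 1 ≤ n) {f g : C(USphere n, ℝ)}
    (h : ReflectionAligned f g) (hf : ¬ ∃ c : ℝ, ∀ x, f x = c) (hg : ¬ ∃ c : ℝ, ∀ x, g x = c) :
    ∃ v, moment f v ≠ 0 := by
  by_contra! H
  obtain ⟨y, z, hyz⟩ : ∃ y z, g z < g y := by
    by_contra! hle
    exact hg ⟨g (north n), fun x => le_antisymm (hle _ _) (hle _ _)⟩
  have hne : (y : Ambient n) - (z : Ambient n) ≠ 0 := sub_ne_zero.2 fun h => by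
    rw [Subtype.ext h] at hyz
    exact lt_irrefl _ hyz
  have hy : 0 < inner ℝ (y : Ambient n) ((y : Ambient n) - (z : Ambient n)) := by
    have h1 := norm_sub_sq_real (y : Ambient n) z
    have h2 := norm_pos_iff.2 hne
    rw [inner_sub_right, real_inner_self_eq_norm_sq]
    simp only [norm_eq_of_mem_sphere] at h1 ⊢
    nlinarith
  have hcont : ContinuousAt (fun v => g (refl v y)) ((y : Ambient n) - (z : Ambient n)) := by
    refine g.continuous.continuousAt.comp ?_
    rw [Topology.IsInducing.subtypeVal.continuousAt_iff]
    have h0 : ‖(y : Ambient n) - (z : Ambient n)‖ ^ 2 ≠ 0 :=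
      pow_ne_zero _ (norm_ne_zero_iff.2 hne)
    simp only [Function.comp_def, coe_refl]
    fun_prop (disch := assumption)
  have hev : ∀ᶠ v in nhds ((y : Ambient n) - (z : Ambient n)),
      0 < inner ℝ (y : Ambient n) v ∧ g (refl v y) < g y := by
    refine Filter.Eventually.and ?_ ?_
    · exact (by fun_prop : Continuous fun v => inner ℝ (y : Ambient n) v).continuousAt
        |>.eventually_const_lt hy
    · exact hcont.eventually_lt_const (by simpa only [refl_sub] using hyz)
  obtain ⟨U, hU, hUo, hmem⟩ := eventually_nhds_iff.1 hev
  exact hf (exists_eq_const_of_comp_refl_eq hn hUo ⟨_, hmem⟩ fun v hv =>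
    (h.isPolarized (hU v hv).1 (hU v hv).2).comp_refl_eq (H v))

theorem exists_inner_eq_moment (F : C(USphere n, ℝ)) :
    ∃ m : Ambient n, ∀ v, moment F v = inner ℝ m v := by
  have hc : Continuous fun x : USphere n => F x • (x : Ambient n) := by fun_prop
  have hi : Integrable (fun x : USphere n => F x • (x : Ambient n)) (surf n) :=
    hc.integrable_of_hasCompactSupport (HasCompactSupport.of_compactSpace _)
  refine ⟨∫ x, F x • (x : Ambient n) ∂surf n, fun v => ?_⟩
  rw [real_inner_comm, ← integral_inner hi]
  simp only [inner_smul_right, real_inner_comm v, moment]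

theorem exists_pos_smul_of_halfspace {E : Type*} [NormedAddCommGroup E] [InnerProductSpace ℝ E]
    {a b : E} (ha : a ≠ 0) (hb : b ≠ 0) (h : ∀ v, 0 < inner ℝ a v → 0 ≤ inner ℝ b v) :
    ∃ c : ℝ, 0 < c ∧ b = c • a := by
  have ha' : 0 < ‖a‖ ^ 2 := by
    have := norm_pos_iff.2 ha
    positivity
  set c : ℝ := inner ℝ b a / ‖a‖ ^ 2 with hc
  set p : E := b - c • a with hp
  have hap : inner ℝ a p = 0 := by
    rw [hp, inner_sub_right, inner_smul_right, real_inner_self_eq_norm_sq, hc,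
      div_mul_cancel₀ _ ha'.ne', real_inner_comm, sub_self]
  have hb' : b = c • a + p := by rw [hp]; abel
  have hp0 : p = 0 := by
    by_contra hne
    have hpp : 0 < ‖p‖ ^ 2 := by
      have := norm_pos_iff.2 hne
      positivity
    -- The coefficient is chosen so that this vector has inner product `-1` with `b`, while its
    -- inner product with `a` is still `‖a‖ ^ 2`.
    have h1 := h (a - ((inner ℝ b a + 1) / ‖p‖ ^ 2) • p) (by
      rw [inner_sub_right, inner_smul_right, hap, real_inner_self_eq_norm_sq]
      linarith)
    have h2 : inner ℝ b p = ‖p‖ ^ 2 := by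
      rw [hb', inner_add_left, real_inner_smul_left, hap, real_inner_self_eq_norm_sq]
      ring
    rw [inner_sub_right, inner_smul_right, h2, div_mul_cancel₀ _ hpp.ne'] at h1
    linarith
  rw [hp0, add_zero] at hb'
  refine ⟨c, lt_of_le_of_ne (div_nonneg (h a ?_) ha'.le) ?_, hb'⟩
  · rwa [real_inner_self_eq_norm_sq]
  · intro h0
    rw [← h0, zero_smul] at hb'
    exact hb hb'

theorem ReflectionAligned.exists_isRadialDecreasing (hn : 1 ≤ n) {f g : C(USphere n, ℝ)}
    (h : ReflectionAligned f g) (hf : ¬ ∃ c : ℝ, ∀ x, f x = c) (hg : ¬ ∃ c : ℝ, ∀ x, g x = c) :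
    ∃ u : USphere n, IsRadialDecreasing f u ∧ IsRadialDecreasing g u := by
  obtain ⟨a, ha⟩ := exists_inner_eq_moment f
  obtain ⟨b, hb⟩ := exists_inner_eq_moment g
  have ha0 : a ≠ 0 := by
    rintro rfl
    obtain ⟨v, hv⟩ := h.exists_moment_ne_zero hn hf hg
    exact hv (by simp [ha])
  have hb0 : b ≠ 0 := by
    rintro rfl
    obtain ⟨v, hv⟩ := h.symm.exists_moment_ne_zero hn hg hf
    exact hv (by simp [hb])
  have hgp : ∀ v, 0 < inner ℝ a v → IsPolarized g v := by
    intro v hv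
    obtain ⟨x, hx, hlt⟩ := exists_lt_of_moment_pos (F := f) (v := v) (by rwa [ha])
    exact h.symm.isPolarized hx hlt
  have hfp : ∀ v, 0 < inner ℝ b v → IsPolarized f v := by
    intro v hv
    obtain ⟨x, hx, hlt⟩ := exists_lt_of_moment_pos (F := g) (v := v) (by rwa [hb])
    exact h.isPolarized hx hlt
  obtain ⟨c, hc, rfl⟩ := exists_pos_smul_of_halfspace ha0 hb0 fun v hv => by
    rw [← hb]
    exact (hgp v hv).moment_nonneg
  have hna : 0 < ‖a‖ := norm_pos_iff.2 ha0
  have hpos : ∀ v, 0 < inner ℝ (‖a‖⁻¹ • a) v → 0 < inner ℝ a v := by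
    intro v hv
    rw [real_inner_smul_left] at hv
    exact pos_of_mul_pos_right hv (inv_nonneg.2 hna.le)
  refine ⟨⟨‖a‖⁻¹ • a, by simp [norm_smul, hna.ne']⟩,
    isRadialDecreasing_of_isPolarized fun v hv => hfp v ?_,
    isRadialDecreasing_of_isPolarized fun v hv => hgp v (hpos v hv)⟩
  rw [real_inner_smul_left]
  exact mul_pos hc (hpos v hv)

end USphere

/-! ### The equality case -/

theorem lemma3p3 {n : ℕ} (hn : 1 ≤ n) (k : ℝ → ℝ)
    (hk_bdd : ∃ C : ℝ, ∀ t ∈ Set.Icc (-1 : ℝ) 1, |k t| ≤ C)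
    (hk_mono : StrictMonoOn k (Set.Icc (-1) 1))
    (f g : C(USphere n, ℝ))
    (hf : ¬ ∃ c : ℝ, ∀ x, f x = c) (hg : ¬ ∃ c : ℝ, ∀ x, g x = c)
    (heq : ∫ y, ∫ x, k (USphere.dot x y) * f x * g y ∂(USphere.surf n) ∂(USphere.surf n) =
      ∫ y, ∫ x, k (USphere.dot x y) * USphere.symmetrization hn f x *
        USphere.symmetrization hn g y ∂(USphere.surf n) ∂(USphere.surf n)) :
    ∃ u : USphere n, USphere.IsRadialDecreasing f u ∧ USphere.IsRadialDecreasing g u := by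
  obtain ⟨C, hC⟩ := hk_bdd
  have h11 : (-1 : ℝ) ≤ 1 := by norm_num
  -- Extending `k` by its endpoint values gives a kernel that is monotone, hence measurable, and
  -- bounded on all of `ℝ`.
  set K : ℝ → ℝ := IccExtend h11 (fun t : Icc (-1 : ℝ) 1 => k t) with hKdef
  have hKm : Monotone K :=
    Monotone.IccExtend h11 fun s t hst => hk_mono.monotoneOn s.2 t.2 hst
  have hKk : ∀ t ∈ Icc (-1 : ℝ) 1, K t = k t := fun t ht => IccExtend_of_mem h11 _ ht
  have hKC : ∀ t, |K t| ≤ C := fun t => hC _ (projIcc (-1 : ℝ) 1 h11 t).2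
  have hKs : StrictMonoOn K (Icc (-1) 1) := hk_mono.congr fun t ht => (hKk t ht).symm
  have hI : ∀ F G : C(USphere n, ℝ), USphere.rieszForm K F G =
      ∫ y, ∫ x, k (USphere.dot x y) * F x * G y ∂(USphere.surf n) ∂(USphere.surf n) := by
    intro F G
    rw [USphere.rieszForm_eq_integral_integral hKm hKC]
    simp only [hKk _ (USphere.dot_mem_Icc _ _)]
  refine USphere.ReflectionAligned.exists_isRadialDecreasing hn (fun v x y hx hy => ?_) hf hg
  -- Starting from the polarized pair, not from `(f, g)`, places its integral between those of `(f,
  -- g)` and `(f*, g*)`, which are equal by hypothesis.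
  obtain ⟨F, G, hF, hG, hle⟩ := USphere.exists_continuous_symmetrization hn hKm hKC
    (USphere.polarize_mem_rearrangements (USphere.self_mem_rearrangements f) v)
    (USphere.polarize_mem_rearrangements (USphere.self_mem_rearrangements g) v)
  rw [hF, hG, ← hI, ← hI] at heq
  exact USphere.mul_nonneg_of_rieszForm_polarize_eq hKm hKs hKC
    (le_antisymm (USphere.rieszForm_le_polarize hKm hKC v f g) (hle.trans heq.ge)) hx hy
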